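/- For a group $G$ let $\mathrm{C}(G)$ be its commutator subgroup and $\mathrm{Ab}(G)=G/\mathrm{C}(G)$ its abelianization. An abelian group $A$ is called cotorsion if $\mathrm{Ext}(\mathbb{Q},A)=0$, that is, every short exact sequence $0\to A\to B\to\mathbb{Q}\to 0$ of abelian groups splits. The Ulm subgroups $A^\lambda$ of an abelian group $A$ are defined for all ordinals $\lambda$ by $A^0=A$, $A^{\lambda+1}=\bigcap_{n\ge 1} nA^\lambda$, and $A^\delta=\bigcap_{\lambda<\delta}A^\lambda$ for limit ordinals $\delta$; the Ulm length of $A$ is the least ordinal $\lambda$ with $A^{\lambda+1}=A^\lambda$. Theorem. Let $(H_n)_{n\in\mathbb{N}}$ be a countable collection of groups. Then the natural map $$\rho:\mathrm{Ab}\Big(\prod_{n\in\mathbb{N}}H_n\Big)\longrightarrow\prod_{n\in\mathbb{N}}\mathrm{Ab}(H_n)$$ is surjective. Moreover $\mathrm{C}(\prod_n H_n)\subseteq\prod_n\mathrm{C}(H_n)$, the inclusion $\prod_n \mathrm{C}(H_n)\subseteq\prod_n H_n$ induces an isomorphism $$\prod_{n\in\mathbb{N}}\mathrm{C}(H_n)\Big/\mathrm{C}\Big(\prod_{n\in\mathbb{N}}H_n\Big)\;\cong\;\ker(\rho),$$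 and $\ker(\rho)$ is a cotorsion group whose Ulm length is at most $\aleph_1$ (regarded as the first uncountable ordinal). -/

import Mathlib

universe u v

/-- The natural homomorphism `Ab (∏ Hₙ) → ∏ Ab (Hₙ)`, whose `n`-th component is `Ab` of the
`n`-th projection. -/
def abProdMap (H : ℕ → Type u) [∀ n, Group (H n)] :
    Abelianization (∀ n, H n) →* ∀ n, Abelianization (H n) :=
  MonoidHom.pi fun n => Abelianization.map (Pi.evalMonoidHom H n)

/-- The product `∏ C(Hₙ)` of the commutator subgroups, as a subgroup of `∏ Hₙ`. -/
def prodCommutator (H : ℕ → Type u) [∀ n, Group (H n)] : Subgroup (∀ n, H n) :=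
  Subgroup.pi Set.univ fun n => commutator (H n)

/-- A short exact sequence `0 → A → B → C → 0` of abelian groups. Every such `B` is in bijection
with `A × C`, so the universe chosen for `B` is no restriction up to isomorphism. -/
structure AbExtension (C : Type v) (A : Type u) [AddCommGroup C] [AddCommGroup A] where
  B : Type (max u v)
  [grp : AddCommGroup B]
  inc : A →+ B
  proj : B →+ C
  inc_injective : Function.Injective inc
  proj_surjective : Function.Surjective proj
  exact : inc.range = proj.ker

attribute [instance] AbExtension.grp

namespace AbExtension

variable {C : Type v} {A : Type u} [AddCommGroup C] [AddCommGroup A]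

/-- Equivalence of extensions: an isomorphism of the middle groups that is compatible with the
identities of `A` and `C`. -/
def IsEquivalent (E F : AbExtension C A) : Prop :=
  ∃ e : E.B ≃+ F.B, (∀ a, e (E.inc a) = F.inc a) ∧ ∀ b, F.proj (e b) = E.proj b

variable (C A)

/-- The split extension `0 → A → A ⊕ C → C → 0`, the zero element of `Ext(C, A)`. -/
def split : AbExtension C A where
  B := A × C
  inc := AddMonoidHom.inl A C
  proj := AddMonoidHom.snd A C
  inc_injective := fun a b h => congrArg Prod.fst h
  proj_surjective := fun c => ⟨(0, c), rfl⟩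
  exact := by
    ext ⟨a, c⟩
    rw [AddMonoidHom.mem_range, AddMonoidHom.mem_ker]
    constructor
    · rintro ⟨x, hx⟩
      exact (congrArg Prod.snd hx).symm
    · intro h
      exact ⟨a, Prod.ext rfl (Eq.symm h)⟩

end AbExtension

/-- `A` is cotorsion if `Ext(ℚ, A) = 0`, i.e. the class of every extension of `ℚ` by `A` is the
class of the split extension. -/
def IsCotorsion (A : Type u) [AddCommGroup A] : Prop :=
  ∀ E : AbExtension ℚ A, E.IsEquivalent (AbExtension.split ℚ A)

/-- The Ulm subgroups `A^o` of an abelian group: `A^0 = A`, `A^(o+1) = ⋂_{n ≥ 1} n A^o`, and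
`A^o = ⋂_{l < o} A^l` for a limit ordinal `o`. -/
noncomputable def ulmSubgroup (A : Type u) [AddCommGroup A] (o : Ordinal.{u}) : AddSubgroup A :=
  Ordinal.limitRecOn o ⊤
    (fun _ S => ⨅ n : ℕ, ⨅ _ : 1 ≤ n, S.map (nsmulAddMonoidHom n))
    (fun o _ S => ⨅ l : Ordinal.{u}, ⨅ h : l < o, S l h)

/-- The Ulm length `u(A)`: the least ordinal `o` with `A^(o+1) = A^o`. -/
noncomputable def ulmLength (A : Type u) [AddCommGroup A] : Ordinal.{u} :=
  sInf {o : Ordinal.{u} | ulmSubgroup A (o + 1) = ulmSubgroup A o}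

theorem ulmSubgroup_add_one (A : Type u) [AddCommGroup A] (o : Ordinal.{u}) :
    ulmSubgroup A (o + 1) =
      ⨅ n : ℕ, ⨅ _ : 1 ≤ n, (ulmSubgroup A o).map (nsmulAddMonoidHom n) :=
  Ordinal.limitRecOn_add_one ..

theorem ulmSubgroup_limit (A : Type u) [AddCommGroup A] (o : Ordinal.{u})
    (ho : Order.IsSuccLimit o) :
    ulmSubgroup A o = ⨅ l : Ordinal.{u}, ⨅ _ : l < o, ulmSubgroup A l :=
  Ordinal.limitRecOn_limit _ _ _ _ ho

theorem ulmSubgroup_add_one_le (A : Type u) [AddCommGroup A] (o : Ordinal.{u}) :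
    ulmSubgroup A (o + 1) ≤ ulmSubgroup A o := by
  rw [ulmSubgroup_add_one]
  refine (iInf₂_le 1 le_rfl).trans ?_
  rintro _ ⟨x, hx, rfl⟩
  simpa using hx

theorem ulmSubgroup_antitone (A : Type u) [AddCommGroup A] : Antitone (ulmSubgroup A) := by
  intro a b hab
  induction b using Ordinal.limitRecOn with
  | zero => rw [nonpos_iff_eq_zero.mp hab]
  | add_one b ih =>
    rcases hab.eq_or_lt with rfl | h
    · exact le_rfl
    · exact (ulmSubgroup_add_one_le A b).trans (ih (Order.lt_add_one_iff.mp h))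
  | limit b hb _ =>
    rcases hab.eq_or_lt with rfl | h
    · exact le_rfl
    · rw [ulmSubgroup_limit A b hb]
      exact iInf₂_le a h

/-- The Ulm subgroups stabilize, so the infimum that defines `ulmLength` is a minimum. -/
theorem ulmLength_spec (A : Type u) [AddCommGroup A] :
    ulmSubgroup A (ulmLength A + 1) = ulmSubgroup A (ulmLength A) := by
  refine csInf_mem (s := {o : Ordinal.{u} | ulmSubgroup A (o + 1) = ulmSubgroup A o}) ?_
  by_contra hne
  rw [Set.not_nonempty_iff_eq_empty] at hne
  have hs : StrictAnti (ulmSubgroup A) := fun a b hab =>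
    (ulmSubgroup_antitone A (Order.add_one_le_of_lt hab)).trans_lt
      (lt_of_le_of_ne (ulmSubgroup_add_one_le A a) fun h => by
        have : a ∈ {o : Ordinal.{u} | ulmSubgroup A (o + 1) = ulmSubgroup A o} := h
        simp [hne] at this)
  exact not_injective_of_ordinal _ hs.injective

/-!
An element of `∏ C(Hₙ)` lies in `C(∏ Hₙ)` if and only if, for some `k`, all but finitely many of its
coordinates are products of `k` commutators. So `ker ρ` is a quotient of the countable product
`∏ C(Hₙ)` in which triviality means one of countably many coordinatewise conditions, up to finitely
many coordinates.

Cotorsion: homomorphisms out of `ℚ` amount to sequences with `xₙ = (n + 1) xₙ₊₁`, so an extension of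
`ℚ` by `A` splits as soon as the systems `xₙ = aₙ + (n + 1) xₙ₊₁` are solvable in `A`. In the
quotient, the lift of `aₙ` may be changed to be trivial in the coordinates `m < n`; then each
coordinate sees finitely many nontrivial equations, and backward recursion solves them.

Ulm length: given `a ∈ A^ω₁`, each division by `n + 1` is witnessed by one of countably many labels.
A finite sequence of labels that can be realized with endpoint in `A^o` for every `o < ω₁` extends
by one more label with the same property, as otherwise each label fails at some `o < ω₁` and all of
them fail at the supremum. This gives an infinite sequence of labels whose initial segments are all
realized, and diagonalizing over the coordinates realizes it as a whole, so `a` lies in a divisible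
subgroup.
-/

open Filter

section FactorialChain

open Nat

variable {A : Type u} [AddCommGroup A] {x : ℕ → A}

/-- A factorial chain: successive divisions of `x 0` by `1, 2, 3, …`. Since the fractions `1 / n!`
generate `ℚ`, these are the sequences `n ↦ s (1 / n!)` for homomorphisms `s : ℚ → A`. -/
def IsFactorialChain (x : ℕ → A) : Prop :=
  ∀ n, x n = (n + 1) • x (n + 1)

theorem IsFactorialChain.eq_ascFactorial_nsmul (hx : IsFactorialChain x) (n k : ℕ) :
    x n = (n + 1).ascFactorial k • x (n + k) := by
  induction k with
  | zero => simp
  | succ k ih =>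
    rw [ih, hx (n + k), smul_smul, ascFactorial_succ, mul_comm, add_right_comm n 1 k, add_assoc n k]

theorem IsFactorialChain.zsmul_eq_zsmul (hx : IsFactorialChain x) {m n : ℕ} {s t : ℤ}
    (h : s * n ! = t * m !) : s • x m = t • x n := by
  have hm : (m ! * (m + 1).ascFactorial n : ℤ) = (m + n)! :=
    mod_cast factorial_mul_ascFactorial m n
  have hn : (n ! * (n + 1).ascFactorial m : ℤ) = (m + n)! :=
    mod_cast (factorial_mul_ascFactorial n m).trans (by rw [add_comm])
  have hcoeff : s * (m + 1).ascFactorial n = t * (n + 1).ascFactorial m := by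
    have hpos : (n ! * m ! : ℤ) ≠ 0 := by positivity
    refine mul_left_cancel₀ hpos ?_
    linear_combination (m + n)! * h + s * n ! * hm - t * m ! * hn
  rw [hx.eq_ascFactorial_nsmul m n, hx.eq_ascFactorial_nsmul n m, add_comm n m,
    ← natCast_zsmul, ← natCast_zsmul, smul_smul, smul_smul, hcoeff]

theorem exists_mul_factorial_eq_intCast (q : ℚ) : ∃ (n : ℕ) (t : ℤ), q * n ! = t := by
  refine ⟨q.den, q.num * (q.den - 1)!, ?_⟩
  rw [← mul_factorial_pred q.den_nz]
  push_cast
  rw [← mul_assoc, Rat.mul_den_eq_num]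

theorem IsFactorialChain.exists_ratHom (hx : IsFactorialChain x) :
    ∃ s : ℚ →+ A, ∀ n : ℕ, s (n ! : ℚ)⁻¹ = x n := by
  choose d t hdt using exists_mul_factorial_eq_intCast
  have ht {q : ℚ} {n : ℕ} {k : ℤ} (h : q * n ! = k) : t q • x (d q) = k • x n := by
    refine hx.zsmul_eq_zsmul ?_
    have : (t q * n ! : ℚ) = k * (d q)! := by rw [← hdt, ← h]; ring
    exact_mod_cast this
  have hadd (p q : ℚ) : t (p + q) • x (d (p + q)) = t p • x (d p) + t q • x (d q) := by
    have hp : p * (d p + d q)! = (t p * (d p + 1).ascFactorial (d q) : ℤ) := by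
      rw [← factorial_mul_ascFactorial]
      push_cast
      rw [← mul_assoc, hdt]
    have hq : q * (d p + d q)! = (t q * (d q + 1).ascFactorial (d p) : ℤ) := by
      rw [add_comm, ← factorial_mul_ascFactorial]
      push_cast
      rw [← mul_assoc, hdt]
    rw [ht hp, ht hq, ← add_smul]
    exact ht (by rw [add_mul, hp, hq, Int.cast_add])
  refine ⟨AddMonoidHom.mk' (fun q => t q • x (d q)) hadd, fun n => ?_⟩
  have hone : (n ! : ℚ)⁻¹ * n ! = (1 : ℤ) := by
    rw [inv_mul_cancel₀ (by positivity), Int.cast_one]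
  exact (ht hone).trans (one_zsmul _)

end FactorialChain

section Cotorsion

open Nat

namespace AbExtension

variable {C : Type v} {A : Type u} [AddCommGroup C] [AddCommGroup A]

theorem proj_inc (E : AbExtension C A) (a : A) : E.proj (E.inc a) = 0 := by
  rw [← AddMonoidHom.mem_ker, ← E.exact]
  exact ⟨a, rfl⟩

theorem exists_inc_eq (E : AbExtension C A) {b : E.B} (hb : E.proj b = 0) :
    ∃ a, E.inc a = b := by
  rwa [← AddMonoidHom.mem_ker, ← E.exact] at hb

theorem isEquivalent_split_of_section (E : AbExtension C A) (s : C →+ E.B)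
    (hs : ∀ c, E.proj (s c) = c) : E.IsEquivalent (split C A) := by
  have hexact : Function.Exact E.inc.toIntLinearMap E.proj.toIntLinearMap := fun _ =>
    ⟨E.exists_inc_eq, fun ⟨a, ha⟩ => ha ▸ E.proj_inc a⟩
  obtain ⟨e, hinc, hproj⟩ := hexact.splitSurjectiveEquiv E.inc_injective
    ⟨s.toIntLinearMap, LinearMap.ext hs⟩
  refine ⟨e.toAddEquiv, fun a => ?_, fun b => (LinearMap.congr_fun hproj b).symm⟩
  exact e.eq_symm_apply.mp (LinearMap.congr_fun hinc a)

end AbExtension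

theorem isCotorsion_of_exists_solution {A : Type u} [AddCommGroup A]
    (hA : ∀ a : ℕ → A, ∃ x : ℕ → A, ∀ n, x n = a n + (n + 1) • x (n + 1)) : IsCotorsion A := by
  intro E
  choose b hb using fun n : ℕ => E.proj_surjective (n ! : ℚ)⁻¹
  have hdiff (n : ℕ) : E.proj ((n + 1) • b (n + 1) - b n) = 0 := by
    rw [map_sub, map_nsmul, hb, hb, factorial_succ, nsmul_eq_mul]
    push_cast
    field_simp
    simp
  choose a ha using fun n => E.exists_inc_eq (hdiff n)
  obtain ⟨x, hx⟩ := hA a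
  have hchain : IsFactorialChain fun n => b n + E.inc (x n) := fun n => by
    beta_reduce
    rw [hx n, map_add, ha, map_nsmul, smul_add]
    abel
  obtain ⟨s, hs⟩ := hchain.exists_ratHom
  have hs_one : E.proj (s 1) = 1 := by
    simpa [hb, E.proj_inc] using congrArg E.proj (hs 0)
  refine E.isEquivalent_split_of_section s fun q => ?_
  simpa [hs_one] using map_rat_smul (E.proj.comp s) q 1

end Cotorsion

section Ulm

variable {A : Type u} [AddCommGroup A] {o : Ordinal.{u}}

theorem mem_ulmSubgroup_add_one {a : A} :
    a ∈ ulmSubgroup A (o + 1) ↔ ∀ n : ℕ, 1 ≤ n → ∃ b ∈ ulmSubgroup A o, n • b = a := by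
  simp only [ulmSubgroup_add_one, AddSubgroup.mem_iInf, AddSubgroup.mem_map,
    nsmulAddMonoidHom_apply]

theorem map_mem_ulmSubgroup {D : Type*} [AddCommGroup D] [DivisibleBy D ℤ] (s : D →+ A)
    (o : Ordinal.{u}) (d : D) : s d ∈ ulmSubgroup A o := by
  induction o using Ordinal.limitRecOn generalizing d with
  | zero => simp [ulmSubgroup]
  | add_one o ih =>
    refine mem_ulmSubgroup_add_one.mpr fun n hn => ⟨s (DivisibleBy.div d (n : ℤ)), ih _, ?_⟩
    rw [← map_nsmul, ← natCast_zsmul, DivisibleBy.div_cancel d (by positivity)]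
  | limit o ho ih =>
    simp only [ulmSubgroup_limit A o ho, AddSubgroup.mem_iInf]
    exact fun l hl => ih l hl d

theorem ulmLength_le_of_exists_isFactorialChain
    (h : ∀ a ∈ ulmSubgroup A o, ∃ x : ℕ → A, x 0 = a ∧ IsFactorialChain x) :
    ulmLength A ≤ o := by
  refine csInf_le' (le_antisymm (ulmSubgroup_add_one_le A o) fun a ha => ?_)
  obtain ⟨x, rfl, hx⟩ := h a ha
  obtain ⟨s, hs⟩ := hx.exists_ratHom
  exact hs 0 ▸ map_mem_ulmSubgroup s _ _

end Ulm

section LabelledPaths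

open PiNat

variable {ι X : Type*}

theorem exists_forall_res_of_forall_exists_cons {T : List ι → Prop} (hnil : T [])
    (hcons : ∀ l, T l → ∃ i, T (i :: l)) : ∃ k : ℕ → ι, ∀ j, T (res k j) := by
  choose next hnext using hcons
  let branch : ℕ → {l // T l} := fun j =>
    j.rec ⟨[], hnil⟩ fun _ l => ⟨next l.1 l.2 :: l.1, hnext l.1 l.2⟩
  let k : ℕ → ι := fun j => next (branch j).1 (branch j).2
  have hres (j : ℕ) : res k j = (branch j).1 := by
    induction j with
    | zero => rfl
    | succ j ih => rw [res_succ, ih]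
  exact ⟨k, fun j => hres j ▸ (branch j).2⟩

/-- `Reaches R f l u`: some path from `f` to `u` has the labels `l`, where `R i n v w` means that
the label `i` allows `v → w` as the `n`-th step. The last label comes first in `l`, so that
the paths labelled by the initial segments of `k : ℕ → ι` are those labelled by `PiNat.res k j`. -/
inductive Reaches (R : ι → ℕ → X → X → Prop) (f : X) : List ι → X → Prop
  | nil : Reaches R f [] f
  | cons {i : ι} {l : List ι} {v w : X} :
      Reaches R f l v → R i l.length v w → Reaches R f (i :: l) w

theorem Reaches.exists_path {R : ι → ℕ → X → X → Prop} {f u : X} {k : ℕ → ι} {j : ℕ}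
    (h : Reaches R f (res k j) u) :
    ∃ y : ℕ → X, y 0 = f ∧ y j = u ∧ ∀ n < j, R (k n) n (y n) (y (n + 1)) := by
  induction j generalizing u with
  | zero =>
    cases h
    exact ⟨fun _ => f, rfl, rfl, fun n hn => absurd hn n.not_lt_zero⟩
  | succ j ih =>
    obtain - | ⟨hv, hlast⟩ := h
    obtain ⟨y, hy0, rfl, hy⟩ := ih hv
    rw [res_length] at hlast
    refine ⟨fun n => if n ≤ j then y n else u, by simpa using hy0, by simp, fun n hn => ?_⟩
    rcases (Nat.lt_succ_iff_lt_or_eq.mp hn) with hn | rfl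
    · simpa [hn.le, Nat.succ_le_of_lt hn] using hy n hn
    · simpa using hlast

theorem exists_forall_lt_omega_one_of_antitone [Countable ι] {P : ι → Ordinal.{u} → Prop}
    (hP : ∀ i, Antitone (P i)) (h : ∀ o < Ordinal.omega 1, ∃ i, P i o) :
    ∃ i, ∀ o < Ordinal.omega 1, P i o := by
  by_contra! hfail
  choose l hl hPl using hfail
  obtain ⟨i, hi⟩ := h _ (Ordinal.iSup_lt_omega_one hl)
  exact hPl i (hP i (Ordinal.le_iSup l i) hi)

theorem exists_forall_reaches_of_mem_ulmSubgroup_omega_one [Countable ι] {A : Type u}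
    [AddCommGroup A] {π : X → A} (hπ : Function.Surjective π) {R : ι → ℕ → X → X → Prop}
    (hR : ∀ n v w, π v = (n + 1) • π w → ∃ i, R i n v w) {f : X}
    (hf : π f ∈ ulmSubgroup A (Ordinal.omega 1)) :
    ∃ k : ℕ → ι, ∀ j, ∃ u, Reaches R f (res k j) u := by
  obtain ⟨k, hk⟩ := exists_forall_res_of_forall_exists_cons
    (T := fun l => ∀ o < Ordinal.omega 1, ∃ u, Reaches R f l u ∧ π u ∈ ulmSubgroup A o)
    (fun o ho => ⟨f, .nil, ulmSubgroup_antitone A ho.le hf⟩) fun l hl => by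
      refine exists_forall_lt_omega_one_of_antitone
        (fun i o o' ho ⟨u, hu, hmem⟩ => ⟨u, hu, ulmSubgroup_antitone A ho hmem⟩) fun o ho => ?_
      obtain ⟨v, hv, hvo⟩ := hl (o + 1) ((Cardinal.isSuccLimit_omega 1).add_one_lt ho)
      obtain ⟨b, hb, hbv⟩ := mem_ulmSubgroup_add_one.mp hvo (l.length + 1) (Nat.le_add_left 1 _)
      obtain ⟨w, rfl⟩ := hπ b
      obtain ⟨i, hi⟩ := hR _ v w hbv.symm
      exact ⟨i, w, hv.cons hi, hb⟩
  exact ⟨k, fun j => (hk j 0 (Ordinal.omega_pos 1)).imp fun _ hu => hu.1⟩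

end LabelledPaths

section ReducedProduct

variable {C : ℕ → Type v}

theorem exists_seq_eq_apply_succ {X : Type*} (c : X) (φ : ℕ → X → X) (N : ℕ)
    (hφ : ∀ n ≥ N, φ n c = c) : ∃ x : ℕ → X, ∀ n, x n = φ n (x (n + 1)) := by
  induction N generalizing φ with
  | zero => exact ⟨fun _ => c, fun n => (hφ n n.zero_le).symm⟩
  | succ N ih =>
    obtain ⟨x, hx⟩ := ih (fun n => φ (n + 1)) fun n hn => hφ (n + 1) (Nat.succ_le_succ hn)
    exact ⟨fun n => n.casesOn (φ 0 (x 0)) x, fun n => by cases n <;> simp [← hx]⟩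

theorem exists_tendsto_atTop_of_eventually {p : ℕ → ℕ → Prop} (h0 : ∀ m, p 0 m)
    (h : ∀ j, ∀ᶠ m in atTop, p j m) :
    ∃ J : ℕ → ℕ, Tendsto J atTop atTop ∧ ∀ m, p (J m) m := by
  classical
  refine ⟨fun m => Nat.findGreatest (p · m) m, tendsto_atTop.mpr fun j => ?_,
    fun m => Nat.findGreatest_spec (P := (p · m)) m.zero_le (h0 m)⟩
  filter_upwards [eventually_ge_atTop j, h j] with m hm hp
  exact Nat.le_findGreatest hm hp

theorem exists_seq_eventually_of_forall_exists_path {R : ℕ → ∀ m, C m → C m → Prop}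
    {f : ∀ m, C m}
    (h : ∀ j, ∃ y : ℕ → ∀ m, C m,
      y 0 = f ∧ ∀ n < j, ∀ᶠ m in atTop, R n m (y n m) (y (n + 1) m)) :
    ∃ y : ℕ → ∀ m, C m, y 0 = f ∧ ∀ n, ∀ᶠ m in atTop, R n m (y n m) (y (n + 1) m) := by
  choose y hy0 hy using h
  obtain ⟨J, hJ, hyJ⟩ := exists_tendsto_atTop_of_eventually
    (p := fun j m => ∀ n < j, R n m (y j n m) (y j (n + 1) m))
    (fun _ n hn => absurd hn n.not_lt_zero)
    fun j => (eventually_all_finite (Set.finite_Iio j)).mpr (hy j)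
  refine ⟨fun n m => y (J m) n m, funext fun m => congrFun (hy0 (J m)) m, fun n => ?_⟩
  filter_upwards [hJ.eventually_gt_atTop n] with m hm
  exact hyJ m n hm

variable [∀ m, Group (C m)] {K : Type u} [CommGroup K] {π : (∀ m, C m) →* K}

theorem isCotorsion_of_map_eq_one_of_eventually_eq_one (hπ : Function.Surjective π)
    (hfin : ∀ f : ∀ m, C m, (∀ᶠ m in atTop, f m = 1) → π f = 1) : IsCotorsion (Additive K) := by
  refine isCotorsion_of_exists_solution fun a => ?_
  choose α hα using fun n => hπ (a n).toMul
  let β : ℕ → ∀ m, C m := fun n m => if n ≤ m then α n m else 1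
  have hβ (n : ℕ) : π (β n) = (a n).toMul := by
    rw [← hα, ← div_eq_one, ← map_div]
    refine hfin _ ?_
    filter_upwards [eventually_ge_atTop n] with m hm
    simp [β, hm]
  choose x hx using fun m => exists_seq_eq_apply_succ (1 : C m) (fun n z => β n m * z ^ (n + 1))
    (m + 1) fun n hn => by simp [β, Nat.not_le.mpr hn]
  have hsol (n : ℕ) : (fun m => x m n) = β n * (fun m => x m (n + 1)) ^ (n + 1) :=
    funext fun m => hx m n
  refine ⟨fun n => .ofMul (π fun m => x m n), fun n => ?_⟩
  beta_reduce
  rw [hsol, map_mul, map_pow, hβ]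
  rfl

theorem ulmLength_le_omega_one_of_map_eq_one_iff (hπ : Function.Surjective π)
    {κ : Type*} [Countable κ] (S : κ → ∀ m, Set (C m))
    (hS : ∀ f : ∀ m, C m, π f = 1 ↔ ∃ k, ∀ᶠ m in atTop, f m ∈ S k m) :
    ulmLength (Additive K) ≤ Ordinal.omega 1 := by
  have hstep (n : ℕ) (v w : ∀ m, C m) :
      Additive.ofMul (π v) = (n + 1) • Additive.ofMul (π w) ↔
        ∃ k, ∀ᶠ m in atTop, v m / w m ^ (n + 1) ∈ S k m := by
    rw [← ofMul_pow, Additive.ofMul.injective.eq_iff, ← div_eq_one, ← map_pow, ← map_div, hS]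
    rfl
  refine ulmLength_le_of_exists_isFactorialChain fun a ha => ?_
  obtain ⟨f, rfl⟩ := (Additive.ofMul.surjective.comp hπ) a
  obtain ⟨k, hk⟩ := exists_forall_reaches_of_mem_ulmSubgroup_omega_one
    (Additive.ofMul.surjective.comp hπ) (fun n v w => (hstep n v w).mp) ha
  obtain ⟨y, rfl, hy⟩ := exists_seq_eventually_of_forall_exists_path
    (R := fun n m v w => v / w ^ (n + 1) ∈ S (k n) m) fun j => by
    obtain ⟨u, hu⟩ := hk j
    obtain ⟨y, hy0, -, hy⟩ := hu.exists_path
    exact ⟨y, hy0, hy⟩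
  exact ⟨fun n => .ofMul (π (y n)), rfl, fun n => (hstep n _ _).mpr ⟨k n, hy n⟩⟩

end ReducedProduct

section Commutator

open scoped Pointwise

theorem inv_commutatorSet (G : Type*) [Group G] : (commutatorSet G)⁻¹ = commutatorSet G := by
  ext g
  rw [Set.mem_inv, mem_commutatorSet_iff, mem_commutatorSet_iff, exists_comm]
  simp only [← inv_eq_iff_eq_inv, commutatorElement_inv]

theorem mem_closure_iff_exists_mem_pow {G : Type*} [Group G] {s : Set G} (hs : s⁻¹ = s)
    {g : G} : g ∈ Subgroup.closure s ↔ ∃ k : ℕ, g ∈ s ^ k := by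
  constructor
  · intro hg
    induction hg using Subgroup.closure_induction with
    | mem x hx => exact ⟨1, by rwa [pow_one]⟩
    | one => exact ⟨0, by rw [pow_zero, Set.mem_one]⟩
    | mul x y _ _ hx hy =>
      obtain ⟨k, hk⟩ := hx
      obtain ⟨l, hl⟩ := hy
      exact ⟨k + l, pow_add s k l ▸ Set.mul_mem_mul hk hl⟩
    | inv x _ hx =>
      obtain ⟨k, hk⟩ := hx
      refine ⟨k, ?_⟩
      rwa [← hs, inv_pow, Set.inv_mem_inv]
  · rintro ⟨k, hk⟩
    obtain ⟨f, rfl⟩ := Set.mem_pow.mp hk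
    exact list_prod_mem (by simpa [List.mem_ofFn'] using fun i => Subgroup.subset_closure (f i).2)

theorem mem_commutator_iff_exists_mem_pow {G : Type*} [Group G] {g : G} :
    g ∈ commutator G ↔ ∃ k : ℕ, g ∈ commutatorSet G ^ k := by
  rw [commutator_eq_closure, mem_closure_iff_exists_mem_pow (inv_commutatorSet G)]

theorem mem_univ_pi_pow {ι : Type*} {M : ι → Type*} [∀ i, Monoid (M i)] {s : ∀ i, Set (M i)} {k : ℕ}
    {f : ∀ i, M i} : f ∈ Set.univ.pi s ^ k ↔ ∀ i, f i ∈ s i ^ k := by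
  induction k generalizing f with
  | zero => simp [funext_iff]
  | succ k ih =>
    simp only [pow_succ, Set.mem_mul]
    constructor
    · rintro ⟨a, ha, b, hb, rfl⟩ i
      exact ⟨a i, ih.mp ha i, b i, hb i trivial, rfl⟩
    · intro h
      choose a ha b hb hab using h
      exact ⟨a, ih.mpr ha, b, fun i _ => hb i, funext hab⟩

variable {ι : Type*} {H : ι → Type*} [∀ i, Group (H i)]

theorem commutatorSet_pi : commutatorSet (∀ i, H i) = Set.univ.pi fun i => commutatorSet (H i) := by
  ext f
  simp only [mem_commutatorSet_iff, Set.mem_univ_pi]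
  exact ⟨fun ⟨a, b, h⟩ i => ⟨a i, b i, congrFun h i⟩, fun h => by
    choose a b hab using h
    exact ⟨a, b, funext hab⟩⟩

theorem mem_commutator_pi_iff_eventually {f : ∀ i, H i} (hf : ∀ i, f i ∈ commutator (H i)) :
    f ∈ commutator (∀ i, H i) ↔ ∃ k : ℕ, ∀ᶠ i in cofinite, f i ∈ commutatorSet (H i) ^ k := by
  simp only [mem_commutator_iff_exists_mem_pow, commutatorSet_pi, mem_univ_pi_pow] at hf ⊢
  constructor
  · rintro ⟨k, hk⟩
    exact ⟨k, .of_forall hk⟩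
  · rintro ⟨k, hk⟩
    choose c hc using hf
    obtain ⟨b, hb⟩ := (Set.Finite.image c (eventually_cofinite.mp hk)).bddAbove
    refine ⟨max k b, fun i => ?_⟩
    have hmono {p : ℕ} (hp : p ≤ max k b) (hi : f i ∈ commutatorSet (H i) ^ p) :
        f i ∈ commutatorSet (H i) ^ max k b :=
      Set.pow_subset_pow_right (one_mem_commutatorSet (H i)) hp hi
    by_cases hi : f i ∈ commutatorSet (H i) ^ k
    · exact hmono (le_max_left k b) hi
    · exact hmono ((hb ⟨i, hi, rfl⟩).trans (le_max_right k b)) (hc i)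

end Commutator

section AbProdMap

variable (H : ℕ → Type u) [∀ n, Group (H n)]

theorem abProdMap_surjective : Function.Surjective (abProdMap H) := by
  intro y
  choose f hf using fun n => QuotientGroup.mk_surjective (y n)
  exact ⟨Abelianization.of f, funext hf⟩

variable {H} in
theorem mem_prodCommutator {f : ∀ n, H n} :
    f ∈ prodCommutator H ↔ ∀ n, f n ∈ commutator (H n) := by
  simp only [prodCommutator, Subgroup.mem_pi, Set.mem_univ, true_imp_iff]

theorem commutator_pi_le_prodCommutator : commutator (∀ n, H n) ≤ prodCommutator H := by
  rw [commutator_def, ← Subgroup.pi_top Set.univ]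
  exact Subgroup.commutator_pi_pi_le _ _

variable {H} in
theorem of_mem_ker_abProdMap {f : ∀ n, H n} :
    Abelianization.of f ∈ (abProdMap H).ker ↔ f ∈ prodCommutator H := by
  simp only [mem_prodCommutator, ← Abelianization.ker_of, MonoidHom.mem_ker]
  exact funext_iff

/-- The restriction `∏ C(Hₙ) → ker ρ` of the projection `∏ Hₙ → Ab (∏ Hₙ)`. -/
def prodCommutatorToKer : prodCommutator H →* (abProdMap H).ker :=
  (Abelianization.of.comp (prodCommutator H).subtype).codRestrict _
    fun f => of_mem_ker_abProdMap.mpr f.2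

theorem prodCommutatorToKer_surjective : Function.Surjective (prodCommutatorToKer H) := by
  rintro ⟨y, hy⟩
  obtain ⟨f, rfl⟩ := QuotientGroup.mk_surjective y
  exact ⟨⟨f, of_mem_ker_abProdMap.mp hy⟩, rfl⟩

theorem ker_prodCommutatorToKer :
    (prodCommutatorToKer H).ker = (commutator (∀ n, H n)).subgroupOf (prodCommutator H) := by
  rw [prodCommutatorToKer, MonoidHom.ker_codRestrict, ← MonoidHom.comap_ker, Abelianization.ker_of]
  rfl

/-- The isomorphism `∏ C(Hₙ) / C(∏ Hₙ) ≃ ker ρ` induced by the inclusion `∏ C(Hₙ) ⊆ ∏ Hₙ`. -/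
noncomputable def prodCommutatorQuotientEquivKer :
    prodCommutator H ⧸ (commutator (∀ n, H n)).subgroupOf (prodCommutator H) ≃*
      (abProdMap H).ker :=
  (QuotientGroup.quotientMulEquivOfEq (ker_prodCommutatorToKer H).symm).trans
    (QuotientGroup.quotientKerEquivOfSurjective _ (prodCommutatorToKer_surjective H))

/-- The group `∏ C(Hₙ)` as a subgroup of `∏ Hₙ` is the product of the groups `C(Hₙ)`. -/
def piCommutatorEquiv : (∀ n, commutator (H n)) ≃* prodCommutator H where
  toFun f := ⟨fun n => f n, mem_prodCommutator.mpr fun n => (f n).2⟩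
  invFun f n := ⟨f.1 n, mem_prodCommutator.mp f.2 n⟩
  map_mul' _ _ := rfl

/-- The projection `∏ C(Hₙ) → ker ρ` out of the product of the groups `C(Hₙ)`. -/
def piCommutatorToKer : (∀ n, commutator (H n)) →* (abProdMap H).ker :=
  (prodCommutatorToKer H).comp (piCommutatorEquiv H).toMonoidHom

theorem piCommutatorToKer_surjective : Function.Surjective (piCommutatorToKer H) :=
  (prodCommutatorToKer_surjective H).comp (piCommutatorEquiv H).surjective

open scoped Pointwise in
variable {H} in
theorem piCommutatorToKer_eq_one_iff (f : ∀ n, commutator (H n)) :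
    piCommutatorToKer H f = 1 ↔
      ∃ k : ℕ, ∀ᶠ n in atTop,
        f n ∈ ((↑) ⁻¹' (commutatorSet (H n) ^ k) : Set (commutator (H n))) := by
  rw [piCommutatorToKer, MonoidHom.comp_apply, ← MonoidHom.mem_ker, ker_prodCommutatorToKer,
    Subgroup.mem_subgroupOf, ← Nat.cofinite_eq_atTop]
  exact mem_commutator_pi_iff_eventually fun n => (f n).2

theorem piCommutatorToKer_eq_one_of_eventually_eq_one (f : ∀ n, commutator (H n))
    (hf : ∀ᶠ n in atTop, f n = 1) : piCommutatorToKer H f = 1 := by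
  refine (piCommutatorToKer_eq_one_iff f).mpr ⟨0, hf.mono fun n hn => ?_⟩
  rw [hn]
  exact Set.one_mem_pow (one_mem_commutatorSet (H n))

end AbProdMap

theorem theoremt (H : ℕ → Type u) [∀ n, Group (H n)] :
    Function.Surjective (abProdMap H) ∧
    commutator (∀ n, H n) ≤ prodCommutator H ∧
    (∃ e : (prodCommutator H ⧸ (commutator (∀ n, H n)).subgroupOf (prodCommutator H)) ≃*
        (abProdMap H).ker,
      ∀ x : prodCommutator H,
        (e (QuotientGroup.mk x) : Abelianization (∀ n, H n)) = Abelianization.of (x : ∀ n, H n)) ∧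
    IsCotorsion (Additive (abProdMap H).ker) ∧
    ulmLength (Additive (abProdMap H).ker) ≤ Ordinal.omega 1 :=
  ⟨abProdMap_surjective H, commutator_pi_le_prodCommutator H,
    ⟨prodCommutatorQuotientEquivKer H, fun _ => rfl⟩,
    isCotorsion_of_map_eq_one_of_eventually_eq_one (piCommutatorToKer_surjective H)
      (piCommutatorToKer_eq_one_of_eventually_eq_one H),
    ulmLength_le_omega_one_of_map_eq_one_iff (piCommutatorToKer_surjective H) _
      piCommutatorToKer_eq_one_iff⟩
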